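/- Let $k$ be an algebraically closed field of characteristic zero and $R=k[x_0,x_1,x_2]$. A set of fat points $Z=m_1P_1+\cdots+m_sP_s$ in $\mathbb{P}^2$ (distinct points $P_i$, integers $m_i\ge 1$) has ideal $I_Z=\bigcap_i I_{P_i}^{m_i}$ and Hilbert function $H_Z(t)=\dim_k (R/I_Z)_t$; $P_i$ is a double point of $Z$ if $m_i=2$ and a reduced point of $Z$ if $m_i=1$. Let $\Delta H=(h_0,\ldots,h_\sigma)=(1,2,\ldots,\alpha,h_\alpha,\ldots,h_\sigma)$ be a valid Hilbert function, i.e. a sequence of positive integers (with $h_i=0$ for $i>\sigma$) for which $1\le\alpha\le\sigma+1$, $h_i=i+1$ for $0\le i<\alpha$, and $h_i\ge h_{i+1}$ for all $i\ge\alpha-1$. Put $H(t)=\sum_{j=0}^{t}h_j$, $\sum\Delta H=\sum_{j=0}^{\sigma}h_j$, $h_i^\star=\#\{j\mid h_j\ge i\}$ for $1\le i\le\alpha$, $n_+=\max\{n,0\}$, and $$d=\sum_{i=1}^{\alpha-1}\min\left\{\left\lfloor\frac{(h_i^\star-(i-1))_+}{2}\right\rfloor,\ \#\{k\mid i+1\le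 k\le\alpha\text{ and }h_k^\star\ge i\}\right\}.$$ Then: (i) $\min\left\{\left\lfloor\frac{\sigma+1}{2}\right\rfloor,\alpha-1\right\}\le d\le\binom{\alpha}{2}$. (ii) For every integer $1\le e\le d$ there exists a set of fat points $Z\subseteq\mathbb{P}^2$ consisting of exactly $e$ double points and $(\sum\Delta H)-3e\ge 0$ reduced points with $H_Z=H$. (iii) For $e=\min\left\{\left\lfloor\frac{\sigma+1}{2}\right\rfloor,\alpha-1\right\}$ there exists a set of fat points $Z\subseteq\mathbb{P}^2$ consisting of exactly $e$ double points and $(\sum\Delta H)-3e\ge 0$ reduced points with $H_Z=H$. -/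

import Mathlib

open MvPolynomial

noncomputable section

/-- The projective plane over `k`. -/
abbrev Plane (k : Type*) [Field k] : Type _ := Projectivization k (Fin 3 → k)

/-- The homogeneous ideal `I_P` in `k[x₀, x₁, x₂]` of a point `P` of the plane: it is generated
by the homogeneous polynomials that vanish at `P`. -/
def pointIdeal {k : Type*} [Field k] (P : Plane k) : Ideal (MvPolynomial (Fin 3) k) :=
  Ideal.span {f | (∃ n : ℕ, f.IsHomogeneous n) ∧ MvPolynomial.eval P.rep f = 0}

/-- A set of fat points `m₁P₁ + ⋯ + mₛPₛ`: a finitely supported multiplicity function. -/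
abbrev FatPoints (k : Type*) [Field k] : Type _ := Plane k →₀ ℕ

namespace FatPoints

variable {k : Type*} [Field k]

/-- `I_Z = ⋂ I_{P_i}^{m_i}`. -/
def ideal (Z : FatPoints k) : Ideal (MvPolynomial (Fin 3) k) :=
  ⨅ P ∈ Z.support, pointIdeal P ^ Z P

/-- The graded piece `(I_Z)_i`, as a subspace of `R_i`. -/
def idealPiece (Z : FatPoints k) (i : ℕ) : Submodule k (homogeneousSubmodule (Fin 3) k i) :=
  (Z.ideal.restrictScalars k).comap (homogeneousSubmodule (Fin 3) k i).subtype

/-- `H_Z(i) = dim_k (R / I_Z)_i`, where `(R / I_Z)_i = R_i / (I_Z)_i`. -/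
def hilbertFunction (Z : FatPoints k) (i : ℕ) : ℕ :=
  Module.finrank k (homogeneousSubmodule (Fin 3) k i ⧸ Z.idealPiece i)

/-- `Z` consists of exactly `e` double points and `r` reduced points. -/
def ConsistsOf (Z : FatPoints k) (e r : ℕ) : Prop :=
  (∀ P ∈ Z.support, Z P = 1 ∨ Z P = 2) ∧
  (Z.support.filter fun P => Z P = 2).card = e ∧
  (Z.support.filter fun P => Z P = 1).card = r

end FatPoints

end

/-- `ΔH = (h 0, …, h σ) = (1, 2, …, α, h α, …, h σ)` is a valid Hilbert function. The sequence is
extended by zero after its last nonzero entry `h σ`. -/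
structure IsValidHilbertFunction (h : ℕ → ℕ) (α σ : ℕ) : Prop where
  alpha_pos : 0 < α
  alpha_le : α ≤ σ + 1
  pos : ∀ i ≤ σ, 0 < h i
  zero : ∀ i, σ < i → h i = 0
  initial : ∀ i < α, h i = i + 1
  /-- `h i ≥ h (i + 1)` for all `i ≥ α - 1`. -/
  anti : ∀ i, α ≤ i + 1 → h (i + 1) ≤ h i

/-- The function `H` with first difference `h`, that is `H i = h 0 + ⋯ + h i`. -/
def sumFunction (h : ℕ → ℕ) (i : ℕ) : ℕ := ∑ j ∈ Finset.range (i + 1), h j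

/-- `∑ ΔH`, the sum of all the entries of `(h 0, …, h σ)`. -/
def totalSum (h : ℕ → ℕ) (σ : ℕ) : ℕ := ∑ j ∈ Finset.range (σ + 1), h j

/-- The entry `h_i^⋆ = #{j | h_j ≥ i}` of the conjugate of `(h 0, …, h σ)`. -/
def conjugate (h : ℕ → ℕ) (σ i : ℕ) : ℕ := ((Finset.range (σ + 1)).filter fun j => i ≤ h j).card

/-- The integer `d`. Truncated subtraction of natural numbers is the positive part `(·)₊`,
and division of natural numbers rounds down. -/
def doublePointNumber (h : ℕ → ℕ) (α σ : ℕ) : ℕ :=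
  ∑ i ∈ Finset.Icc 1 (α - 1),
    min ((conjugate h σ i - (i - 1)) / 2)
      ((Finset.Icc (i + 1) α).filter fun k => i ≤ conjugate h σ k).card

noncomputable section

variable {k : Type*} [Field k]

/-! ### Homogeneous forms and ideals of points -/

/-! The coefficient vectors `(1, r, r ^ 2)` of the lines `L_r : x₀ + r x₁ + r² x₂ = 0` lie on a
conic in the dual plane, so distinct lines meet in pairwise distinct points `P(a, b)` and no three
are concurrent. Put double points at some `P(i, j)` with `i < j < α` and reduced points at some
`P(i, j)` with `i < α ≤ j`, then strip off `L_0, L_1, …, L_(α-1)` in this order. When `L_i` is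
stripped, a double point `P(i, j)` contributes 2 to the degree on it, a double point `P(j, i)` with
`j < i` has already dropped to multiplicity one and contributes 1, and a reduced point contributes
1.

If these degrees `c 0 > c 1 > …` are strictly decreasing, they determine the Hilbert function as `∑
min (c m) (t + 1 - m)` (`configHilbert_Ico`). This follows by induction from the residual sequence
of a line, which bounds the codimension from below (`configHilbert_insert_succ`,
`min_lineDegree_le_lineConditions`), and from a count of conditions, which bounds it from above
(`configHilbert_insert_le`). The conjugate partition of `h` is strictly decreasing, and with `c j =
conjugate h σ (j + 1)` the sum equals `sumFunction h` (`sumFunction_eq`).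

It remains to choose the pairs so that twice the outgoing plus the incoming double points on each
`L_i` is at most `c i`; the number `d` counts what a greedy choice achieves (`exists_pairs_of_le`).
Reduced points fill the remaining capacity (`exists_configuration`). -/

lemma MvPolynomial.IsHomogeneous.aeval_const_mul {ι A B : Type*} [CommRing A] [CommRing B]
    [Algebra A B] {f : MvPolynomial ι A} {n : ℕ} (hf : f.IsHomogeneous n) (c : B) (v : ι → B) :
    MvPolynomial.aeval (fun i => c * v i) f = c ^ n * MvPolynomial.aeval v f := by
  rw [aeval_def, aeval_def, eval₂_eq, eval₂_eq, Finset.mul_sum]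
  refine Finset.sum_congr rfl fun d hd => ?_
  have hd' : ∑ i ∈ d.support, d i = n := (hf.degree_eq_sum_deg_support hd).symm
  simp only [mul_pow, Finset.prod_mul_distrib, Finset.prod_pow_eq_pow_sum, hd']
  ring

lemma MvPolynomial.IsHomogeneous.eval_smul_point {ι : Type*} {f : MvPolynomial ι k} {n : ℕ}
    (hf : f.IsHomogeneous n) (c : k) (v : ι → k) : eval (c • v) f = c ^ n * eval v f := by
  exact hf.aeval_const_mul c v

/-- The quotient of a form of degree `m + n` by a nonzero form of degree `m` has degree `n`. -/
lemma MvPolynomial.IsHomogeneous.exists_eq_mul_of_dvd {ι : Type*} {l f : MvPolynomial ι k}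
    {m n : ℕ} (hl : l.IsHomogeneous m) (hf : f.IsHomogeneous (m + n)) (h : l ∣ f) :
    ∃ g : MvPolynomial ι k, g.IsHomogeneous n ∧ f = l * g := by
  obtain ⟨g, rfl⟩ := h
  let _ : GradedAlgebra (homogeneousSubmodule ι k) := MvPolynomial.gradedAlgebra
  refine ⟨DirectSum.decompose (homogeneousSubmodule ι k) g n,
    (mem_homogeneousSubmodule n _).1 (SetLike.coe_mem _), ?_⟩
  have h1 := DirectSum.coe_decompose_mul_add_of_left_mem (homogeneousSubmodule ι k)
    (a := l) (b := g) (i := m) (j := n) hl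
  have h2 := DirectSum.decompose_of_mem_same (homogeneousSubmodule ι k) (x := l * g) hf
  rw [h2] at h1
  exact h1

/-- A substitution that changes the variables by multiples of `l` changes every polynomial by a
multiple of `l`. -/
lemma MvPolynomial.dvd_sub_aeval {ι A : Type*} [CommRing A] {l : MvPolynomial ι A}
    {φ : ι → MvPolynomial ι A} (hφ : ∀ i, l ∣ X i - φ i) (f : MvPolynomial ι A) :
    l ∣ f - aeval φ f := by
  induction f using MvPolynomial.induction_on with
  | C a => simp [algebraMap_eq]
  | add p q hp hq =>
    rw [map_add, add_sub_add_comm]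
    exact dvd_add hp hq
  | mul_X p i hp =>
    rw [map_mul, aeval_X]
    have : p * X i - aeval φ p * φ i = (p - aeval φ p) * X i + aeval φ p * (X i - φ i) := by ring
    rw [this]
    exact dvd_add (hp.mul_right _) ((hφ i).mul_left _)

/-- First order Taylor expansion modulo the square of an ideal. -/
lemma MvPolynomial.sub_taylor_mem_sq {ι A : Type*} [Fintype ι] [CommRing A]
    {I : Ideal (MvPolynomial ι A)} {φ : ι → MvPolynomial ι A} (hφ : ∀ i, X i - φ i ∈ I)
    (f : MvPolynomial ι A) :
    f - aeval φ f - ∑ i, (X i - φ i) * aeval φ (pderiv i f) ∈ I ^ 2 := by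
  classical
  induction f using MvPolynomial.induction_on with
  | C a => simp [algebraMap_eq]
  | add p q hp hq =>
    have := Ideal.add_mem _ hp hq
    convert this using 1
    simp only [map_add, mul_add, Finset.sum_add_distrib]
    ring
  | mul_X p j hp =>
    -- By the product rule, the error for `p * X j` is the error for `p` times `X j`, plus this
    -- second-order term.
    have h1 : (∑ i, (X i - φ i) * aeval φ (pderiv i p)) * (X j - φ j) ∈ I ^ 2 := by
      rw [pow_two]
      exact Ideal.mul_mem_mul (Ideal.sum_mem _ fun i _ => Ideal.mul_mem_right _ _ (hφ i)) (hφ j)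
    have := Ideal.add_mem _ (Ideal.mul_mem_right (X j) _ hp) h1
    convert this using 1
    have h2 : ∑ i, (X i - φ i) * aeval φ (pderiv i (p * X j)) =
        (∑ i, (X i - φ i) * aeval φ (pderiv i p)) * φ j + (X j - φ j) * aeval φ p := by
      simp only [Derivation.leibniz, pderiv_X, smul_eq_mul, map_add, map_mul, aeval_X, mul_add,
        Finset.sum_add_distrib, Finset.sum_mul]
      rw [add_comm]
      congr 1
      · exact Finset.sum_congr rfl fun i _ => by ring
      · rw [Finset.sum_eq_single j]
        · simp
        · intro b _ hb
          simp [hb.symm]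
        · simp
    rw [h2, map_mul, aeval_X]
    ring

/-! ### The points `P(a, b)` and the lines through them -/

/-- The intersection of the lines with parameters `a` and `b`. -/
def pairVec (a b : k) : Fin 3 → k := ![a * b, -(a + b), 1]

/-- The linear form of the line with parameter `r`. -/
def lineForm (r : k) : MvPolynomial (Fin 3) k := X 0 + C r * X 1 + C (r ^ 2) * X 2

lemma pairVec_comm (a b : k) : pairVec a b = pairVec b a := by
  simp [pairVec, mul_comm, add_comm]

lemma pairVec_ne_zero (a b : k) : pairVec a b ≠ 0 := fun h => by
  simpa [pairVec] using congrFun h 2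

/-- This factorization is why the family of lines was chosen: it shows at once that `P(a, b)` lies
on no line of the family other than `a` and `b`. -/
lemma eval_lineForm (r a b : k) : eval (pairVec a b) (lineForm r) = (r - a) * (r - b) := by
  simp [pairVec, lineForm]
  ring

lemma isHomogeneous_lineForm (r : k) : (lineForm r).IsHomogeneous 1 :=
  ((isHomogeneous_X _ _).add (isHomogeneous_C_mul_X _ _)).add (isHomogeneous_C_mul_X _ _)

lemma pderiv_zero_lineForm (r : k) : pderiv 0 (lineForm r) = 1 := by
  simp [lineForm, pderiv_X]

lemma pderiv_one_lineForm (r : k) : pderiv 1 (lineForm r) = C r := by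
  simp [lineForm, pderiv_X]

/-- The point `P(a, b)` of the plane. -/
def pairPoint (a b : k) : Plane k := Projectivization.mk k (pairVec a b) (pairVec_ne_zero a b)

lemma pairPoint_eq_iff {a b c d : k} :
    pairPoint a b = pairPoint c d ↔ (a = c ∧ b = d) ∨ (a = d ∧ b = c) := by
  constructor
  · intro h
    rw [pairPoint, pairPoint, Projectivization.mk_eq_mk_iff'] at h
    obtain ⟨x, hx⟩ := h
    have h2 : x = 1 := by simpa [pairVec] using congrFun hx 2
    subst h2
    have h0 : c * d = a * b := by simpa [pairVec] using congrFun hx 0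
    have h1 : -d + -c = -b + -a := by simpa [pairVec] using congrFun hx 1
    have h3 : (a - c) * (a - d) = 0 := by linear_combination h0 + a * h1
    rcases mul_eq_zero.1 h3 with h | h
    · exact Or.inl ⟨sub_eq_zero.1 h, by linear_combination h1 - h⟩
    · exact Or.inr ⟨sub_eq_zero.1 h, by linear_combination h1 - h⟩
  · rintro (⟨rfl, rfl⟩ | ⟨rfl, rfl⟩)
    · rfl
    · simp only [pairPoint, pairVec_comm]

lemma eval_pairVec_eq_zero_iff {f : MvPolynomial (Fin 3) k} {n : ℕ} (hf : f.IsHomogeneous n)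
    (a b : k) : eval (pairPoint a b).rep f = 0 ↔ eval (pairVec a b) f = 0 := by
  obtain ⟨c, hc⟩ := Projectivization.exists_smul_eq_mk_rep k (pairVec a b) (pairVec_ne_zero a b)
  rw [pairPoint, ← hc, Units.smul_def, hf.eval_smul_point]
  simp

lemma eval_eq_zero_of_mem_pointIdeal {f : MvPolynomial (Fin 3) k} {a b : k}
    (hf : f ∈ pointIdeal (pairPoint a b)) : eval (pairVec a b) f = 0 := by
  have : pointIdeal (pairPoint a b) ≤ RingHom.ker (eval (pairVec a b)) := by
    refine Ideal.span_le.2 ?_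
    rintro g ⟨⟨n, hn⟩, hg⟩
    exact (eval_pairVec_eq_zero_iff hn a b).1 hg
  exact this hf

lemma eval_pderiv_eq_zero_of_mem_sq {f : MvPolynomial (Fin 3) k} {a b : k}
    (hf : f ∈ pointIdeal (pairPoint a b) ^ 2) (i : Fin 3) :
    eval (pairVec a b) (pderiv i f) = 0 := by
  rw [pow_two] at hf
  induction hf using Submodule.mul_induction_on' with
  | mem_mul_mem m hm n hn =>
    simp [Derivation.leibniz, eval_eq_zero_of_mem_pointIdeal hm, eval_eq_zero_of_mem_pointIdeal hn]
  | add x _ y _ hx hy => simp [hx, hy]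

lemma mem_pointIdeal_iff {f : MvPolynomial (Fin 3) k} {n : ℕ} (hf : f.IsHomogeneous n) (a b : k) :
    f ∈ pointIdeal (pairPoint a b) ↔ eval (pairVec a b) f = 0 :=
  ⟨eval_eq_zero_of_mem_pointIdeal, fun h =>
    Ideal.subset_span ⟨⟨n, hf⟩, (eval_pairVec_eq_zero_iff hf a b).2 h⟩⟩

lemma aeval_C_mul_X {ι A : Type*} [CommRing A] {f : MvPolynomial ι A} {n : ℕ}
    (hf : f.IsHomogeneous n) (v : ι → A) (j : ι) :
    aeval (fun i => C (v i) * X j) f = C (eval v f) * (X j : MvPolynomial ι A) ^ n := by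
  have h1 : aeval (fun i => (C (v i) : MvPolynomial ι A)) f = C (eval v f) := by
    exact aeval_algebraMap_apply (MvPolynomial ι A) v f
  rw [← h1, mul_comm, ← hf.aeval_const_mul]
  simp only [mul_comm]

/-- Two partial derivatives suffice: in the Taylor expansion along `X i ↦ v i * X 2`, with `v =
pairVec a b`, the term of `X 2` vanishes because `v 2 = 1`. -/
lemma mem_pointIdeal_sq_iff {f : MvPolynomial (Fin 3) k} {n : ℕ} (hf : f.IsHomogeneous n)
    (a b : k) :
    f ∈ pointIdeal (pairPoint a b) ^ 2 ↔ eval (pairVec a b) f = 0 ∧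
      eval (pairVec a b) (pderiv 0 f) = 0 ∧ eval (pairVec a b) (pderiv 1 f) = 0 := by
  constructor
  · intro h
    exact ⟨eval_eq_zero_of_mem_pointIdeal (Ideal.pow_le_self two_ne_zero h),
      eval_pderiv_eq_zero_of_mem_sq h 0, eval_pderiv_eq_zero_of_mem_sq h 1⟩
  · rintro ⟨h, h0, h1⟩
    have hφ : ∀ i : Fin 3, X i - C (pairVec a b i) * X 2 ∈ pointIdeal (pairPoint a b) := by
      intro i
      rw [mem_pointIdeal_iff ((isHomogeneous_X k i).sub (isHomogeneous_C_mul_X _ _))]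
      simp [pairVec]
    have := sub_taylor_mem_sq hφ f
    rw [aeval_C_mul_X hf, h, Fin.sum_univ_three, aeval_C_mul_X hf.pderiv, h0,
      aeval_C_mul_X hf.pderiv, h1] at this
    simpa [pairVec] using this

/-! ### Codimensions -/

section Codimension

variable {M A B D : Type*} [AddCommGroup M] [Module k M] [AddCommGroup A] [Module k A]
  [AddCommGroup B] [Module k B] [AddCommGroup D] [Module k D]

/-- An exact sequence `A → B → D → 0` induces a short exact sequence of quotients. Injectivity of
`m` is not needed, since `I.comap m` contains its kernel. -/
lemma finrank_quotient_eq_add_of_exact [Module.Finite k B] (m : A →ₗ[k] B) (π : B →ₗ[k] D)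
    (hπ : Function.Surjective π) (hm : LinearMap.ker π = LinearMap.range m) (I : Submodule k B) :
    Module.finrank k (B ⧸ I) =
      Module.finrank k (A ⧸ I.comap m) + Module.finrank k (D ⧸ I.map π) := by
  set ψ : (B ⧸ I) →ₗ[k] (D ⧸ I.map π) := Submodule.mapQ I (I.map π) π (Submodule.le_comap_map _ _)
  set φ : (A ⧸ I.comap m) →ₗ[k] (B ⧸ I) := Submodule.mapQ (I.comap m) I m le_rfl
  have hφ : Function.Injective φ := by
    rw [← LinearMap.ker_eq_bot, eq_bot_iff]
    intro x hx
    obtain ⟨a, rfl⟩ := Submodule.Quotient.mk_surjective _ x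
    rw [LinearMap.mem_ker, Submodule.mapQ_apply, Submodule.Quotient.mk_eq_zero] at hx
    exact (Submodule.Quotient.mk_eq_zero _).2 hx
  have hψ : LinearMap.range ψ = ⊤ := by
    rw [LinearMap.range_eq_top]
    intro y
    obtain ⟨d, rfl⟩ := Submodule.Quotient.mk_surjective _ y
    obtain ⟨b, rfl⟩ := hπ d
    exact ⟨Submodule.Quotient.mk b, rfl⟩
  have hker : LinearMap.ker ψ = LinearMap.range φ := by
    ext x
    obtain ⟨b, rfl⟩ := Submodule.Quotient.mk_surjective _ x
    rw [LinearMap.mem_ker, Submodule.mapQ_apply, Submodule.Quotient.mk_eq_zero]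
    constructor
    · rintro ⟨c, hc, hcb⟩
      have : b - c ∈ LinearMap.range m := by
        rw [← hm, LinearMap.mem_ker, map_sub, hcb, sub_self]
      obtain ⟨a, ha⟩ := this
      refine ⟨Submodule.Quotient.mk a, ?_⟩
      rw [Submodule.mapQ_apply, Submodule.Quotient.eq, ha]
      simpa using hc
    · rintro ⟨y, hy⟩
      obtain ⟨a, rfl⟩ := Submodule.Quotient.mk_surjective _ y
      rw [Submodule.mapQ_apply, Submodule.Quotient.eq] at hy
      refine ⟨b - m a, by simpa using I.neg_mem hy, ?_⟩
      have : π (m a) = 0 := by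
        rw [← LinearMap.mem_ker, hm]
        exact ⟨a, rfl⟩
      rw [map_sub, this, sub_zero]
  have := LinearMap.finrank_range_add_finrank_ker ψ
  rw [hψ, finrank_top, hker, LinearMap.finrank_range_of_inj hφ] at this
  omega

lemma finrank_quotient_inf_le [Module.Finite k M] (V W : Submodule k M) :
    Module.finrank k (M ⧸ V ⊓ W) ≤ Module.finrank k (M ⧸ V) + Module.finrank k (M ⧸ W) := by
  have h1 := V.finrank_quotient_add_finrank
  have h2 := W.finrank_quotient_add_finrank
  have h3 := (V ⊓ W).finrank_quotient_add_finrank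
  have h4 := Submodule.finrank_sup_add_finrank_inf_eq V W
  have h5 := Submodule.finrank_le (V ⊔ W)
  omega

lemma finrank_quotient_anti [Module.Finite k M] {V W : Submodule k M} (h : V ≤ W) :
    Module.finrank k (M ⧸ W) ≤ Module.finrank k (M ⧸ V) := by
  have h1 := V.finrank_quotient_add_finrank
  have h2 := W.finrank_quotient_add_finrank
  have h3 := Submodule.finrank_mono h
  omega

lemma finrank_quotient_inf_iInf_le [Module.Finite k M] {ι : Type*} (T : Finset ι)
    (V : Submodule k M) (W : ι → Submodule k M) :
    Module.finrank k (M ⧸ V ⊓ ⨅ i ∈ T, W i) ≤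
      Module.finrank k (M ⧸ V) + ∑ i ∈ T, Module.finrank k (M ⧸ W i) := by
  classical
  induction T using Finset.induction_on with
  | empty =>
    have : V ⊓ ⨅ i ∈ (∅ : Finset ι), W i = V := by simp
    rw [this, Finset.sum_empty, add_zero]
  | insert i T hi ih =>
    rw [Finset.iInf_insert, Finset.sum_insert hi, inf_left_comm]
    have := finrank_quotient_inf_le (W i) (V ⊓ ⨅ i ∈ T, W i)
    omega

lemma finrank_quotient_ker_le [Module.Finite k D] (φ : M →ₗ[k] D) :
    Module.finrank k (M ⧸ LinearMap.ker φ) ≤ Module.finrank k D := by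
  rw [φ.quotKerEquivRange.finrank_eq]
  exact Submodule.finrank_le _

end Codimension

/-! ### Univariate polynomials of bounded degree -/

lemma finrank_degreeLT (n : ℕ) : Module.finrank k (Polynomial.degreeLT k n) = n := by
  rw [(Polynomial.degreeLTEquiv k n).finrank_eq, Module.finrank_fin_fun]

instance finite_degreeLT (n : ℕ) : Module.Finite k (Polynomial.degreeLT k n) :=
  Module.Finite.equiv (Polynomial.degreeLTEquiv k n).symm

/-- Polynomials of degree below `min q.natDegree n` inject into the quotient, as no nonzero one is a
multiple of `q`. -/
lemma min_natDegree_le_finrank_quotient_degreeLT {n : ℕ} {q : Polynomial k} (hq : q ≠ 0)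
    (J : Submodule k (Polynomial.degreeLT k n)) (hJ : ∀ f ∈ J, q ∣ (f : Polynomial k)) :
    min q.natDegree n ≤ Module.finrank k (Polynomial.degreeLT k n ⧸ J) := by
  set i := Submodule.inclusion (Polynomial.degreeLT_mono (R := k) (min_le_right q.natDegree n))
  have hinj : Function.Injective (J.mkQ.comp i) := by
    rw [← LinearMap.ker_eq_bot, eq_bot_iff]
    rintro ⟨f, hf⟩ hx
    rw [LinearMap.mem_ker, LinearMap.comp_apply, Submodule.mkQ_apply,
      Submodule.Quotient.mk_eq_zero] at hx
    have h1 : q ∣ f := hJ _ hx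
    have h2 : f = 0 := by
      refine Polynomial.eq_zero_of_dvd_of_degree_lt h1 ?_
      rw [Polynomial.degree_eq_natDegree hq]
      exact (Polynomial.mem_degreeLT.1 hf).trans_le (by exact_mod_cast min_le_left _ _)
    exact Subtype.ext h2
  have := LinearMap.finrank_le_finrank_of_injective hinj
  rwa [finrank_degreeLT] at this

/-! ### Restriction to a line -/

/-- Restriction of a polynomial to the line with parameter `r`, which is parametrized by
`s ↦ P(r, s)`. -/
def lineRestrict (r : k) : MvPolynomial (Fin 3) k →ₐ[k] Polynomial k :=
  aeval ![Polynomial.C r * Polynomial.X, -(Polynomial.C r + Polynomial.X), 1]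

lemma eval_lineRestrict (r s : k) (f : MvPolynomial (Fin 3) k) :
    (lineRestrict r f).eval s = eval (pairVec r s) f := by
  have : (Polynomial.evalRingHom s).comp (lineRestrict r).toRingHom = eval (pairVec r s) := by
    refine MvPolynomial.ringHom_ext (fun a => by simp [lineRestrict]) fun i => ?_
    fin_cases i <;> simp [lineRestrict, pairVec]
  exact congrArg (fun g => g f) this

lemma derivative_lineRestrict (r : k) (f : MvPolynomial (Fin 3) k) :
    Polynomial.derivative (lineRestrict r f) =
      Polynomial.C r * lineRestrict r (pderiv 0 f) - lineRestrict r (pderiv 1 f) := by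
  induction f using MvPolynomial.induction_on with
  | C a => simp [lineRestrict]
  | add p q hp hq =>
    simp only [map_add, hp, hq]
    ring
  | mul_X p i hp =>
    have hX : Polynomial.derivative (lineRestrict r (X i)) = Polynomial.C r *
        lineRestrict r (pderiv 0 (X i)) - lineRestrict r (pderiv 1 (X i)) := by
      fin_cases i <;> simp [lineRestrict, pderiv_X]
    simp only [map_mul, map_add, Polynomial.derivative_mul, hp, hX, Derivation.leibniz, smul_eq_mul]
    ring

lemma natDegree_lineRestrict_le {f : MvPolynomial (Fin 3) k} {t : ℕ} (hf : f.IsHomogeneous t)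
    (r : k) : (lineRestrict r f).natDegree ≤ t := by
  rw [lineRestrict, aeval_def, eval₂_eq]
  refine Polynomial.natDegree_sum_le_of_forall_le _ _ fun d hd => ?_
  rw [hf.degree_eq_sum_deg_support hd]
  refine (Polynomial.natDegree_C_mul_le _ _).trans ((Polynomial.natDegree_prod_le _ _).trans
    (Finset.sum_le_sum fun i _ => ?_))
  refine Polynomial.natDegree_pow_le.trans ?_
  refine (Nat.mul_le_mul_left (d i) (?_ : _ ≤ 1)).trans_eq (mul_one _)
  fin_cases i
  · exact (Polynomial.natDegree_C_mul_le _ _).trans Polynomial.natDegree_X_le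
  · simp only [Fin.mk_one, Matrix.cons_val_one, Matrix.cons_val_zero, Polynomial.natDegree_neg]
    rw [add_comm]
    exact (Polynomial.natDegree_X_add_C r).le
  · simp

lemma lineForm_dvd_iff [Infinite k] {f : MvPolynomial (Fin 3) k} {t : ℕ} (hf : f.IsHomogeneous t)
    (r : k) : lineForm r ∣ f ↔ lineRestrict r f = 0 := by
  constructor
  · rintro ⟨g, rfl⟩
    have : lineRestrict r (lineForm r) = 0 := by
      simp [lineRestrict, lineForm]
      ring
    rw [map_mul, this, zero_mul]
  · intro h
    set φ : Fin 3 → MvPolynomial (Fin 3) k := ![-(C r * X 1 + C (r ^ 2) * X 2), X 1, X 2] with hφ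
    have h1 : lineForm r ∣ f - aeval φ f := by
      refine dvd_sub_aeval (fun i => ?_) f
      fin_cases i
      · refine dvd_of_eq ?_
        simp [hφ, lineForm]
        ring
      · simp [hφ]
      · simp [hφ]
    -- The parametrization `s ↦ P(r, s)` misses the point of the line with `x₂ = 0`; the factor `X
    -- 2` takes care of it.
    have h2 : aeval φ f * X 2 = 0 := by
      refine MvPolynomial.funext fun x => ?_
      rw [map_mul, eval_X, map_zero]
      by_cases hx : x 2 = 0
      · rw [hx, mul_zero]
      · have h3 : eval x (aeval φ f) = eval (x 2 • pairVec r (-(x 1 / x 2) - r)) f := by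
          have : (eval x).comp (aeval φ).toRingHom =
              eval (x 2 • pairVec r (-(x 1 / x 2) - r)) := by
            refine MvPolynomial.ringHom_ext (fun a => by simp) fun i => ?_
            fin_cases i
            · simp [hφ, pairVec]
              field_simp
              ring
            · simp [hφ, pairVec]
              field_simp
            · simp [hφ, pairVec]
          exact congrArg (fun g => g f) this
        rw [h3, hf.eval_smul_point, ← eval_lineRestrict, h]
        simp
    have h3 : aeval φ f = 0 := (mul_eq_zero.1 h2).resolve_right (X_ne_zero _)
    rwa [h3, sub_zero] at h1

/-- Restriction to a line, from forms of degree `t` to polynomials of degree at most `t`. -/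
def formRestrict (r : k) (t : ℕ) :
    homogeneousSubmodule (Fin 3) k t →ₗ[k] Polynomial.degreeLT k (t + 1) :=
  ((lineRestrict r).toLinearMap.comp (homogeneousSubmodule (Fin 3) k t).subtype).codRestrict _
    fun f => Polynomial.mem_degreeLT.2 <| Polynomial.degree_le_natDegree.trans_lt <| by
      exact_mod_cast Nat.lt_succ_of_le (natDegree_lineRestrict_le f.2 r)

lemma coe_formRestrict (r : k) (t : ℕ) (f : homogeneousSubmodule (Fin 3) k t) :
    (formRestrict r t f : Polynomial k) = lineRestrict r f := rfl

lemma formRestrict_surjective (r : k) (t : ℕ) : Function.Surjective (formRestrict r t) := by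
  rw [← LinearMap.range_eq_top, eq_top_iff, ← (Polynomial.degreeLT.basis k (t + 1)).span_eq,
    Submodule.span_le]
  rintro _ ⟨i, rfl⟩
  have hi : (i : ℕ) ≤ t := Nat.lt_succ_iff.1 i.2
  -- On the line, `-X 1 - C r * X 2` restricts to the parameter and `X 2` to `1`, so this form
  -- restricts to the `i`-th monomial.
  have h : ((-X 1 - C r * X 2) ^ (i : ℕ) * X 2 ^ (t - i) :
      MvPolynomial (Fin 3) k).IsHomogeneous t := by
    have := (((isHomogeneous_X k (1 : Fin 3)).neg.sub (isHomogeneous_C_mul_X r (2 : Fin 3))).pow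
      (i : ℕ)).mul (isHomogeneous_X_pow (R := k) (2 : Fin 3) (t - i))
    rwa [one_mul, Nat.add_sub_cancel' hi] at this
  refine ⟨⟨_, h⟩, Subtype.ext ?_⟩
  rw [coe_formRestrict, Polynomial.degreeLT.basis_val]
  simp [lineRestrict]

/-- Multiplication by the linear form of a line. -/
def mulLineForm (r : k) (t : ℕ) :
    homogeneousSubmodule (Fin 3) k t →ₗ[k] homogeneousSubmodule (Fin 3) k (t + 1) :=
  ((LinearMap.mulLeft k (lineForm r)).comp (homogeneousSubmodule (Fin 3) k t).subtype).codRestrict _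
    fun f => by
      have := (isHomogeneous_lineForm r).mul ((mem_homogeneousSubmodule _ _).1 f.2)
      rwa [add_comm] at this

lemma coe_mulLineForm (r : k) (t : ℕ) (f : homogeneousSubmodule (Fin 3) k t) :
    (mulLineForm r t f : MvPolynomial (Fin 3) k) = lineForm r * f := rfl

lemma ker_formRestrict_succ [Infinite k] (r : k) (t : ℕ) :
    LinearMap.ker (formRestrict r (t + 1)) = LinearMap.range (mulLineForm r t) := by
  ext f
  have hf := (mem_homogeneousSubmodule _ _).1 f.2
  rw [LinearMap.mem_ker, ← Subtype.coe_inj, coe_formRestrict, Submodule.coe_zero,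
    ← lineForm_dvd_iff hf]
  constructor
  · intro h
    obtain ⟨g, hg, hfg⟩ := (isHomogeneous_lineForm r).exists_eq_mul_of_dvd (n := t)
      (add_comm t 1 ▸ hf) h
    exact ⟨⟨g, hg⟩, Subtype.ext hfg.symm⟩
  · rintro ⟨g, rfl⟩
    exact ⟨g, rfl⟩

lemma ker_formRestrict_zero (r : k) : LinearMap.ker (formRestrict r 0) = ⊥ := by
  rw [eq_bot_iff]
  rintro ⟨f, hf⟩ h
  rw [LinearMap.mem_ker, ← Subtype.coe_inj, coe_formRestrict] at h
  rw [homogeneousSubmodule_zero] at hf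
  obtain ⟨c, rfl⟩ := Submodule.mem_one.1 hf
  refine Subtype.ext ?_
  simpa [algebraMap_eq, lineRestrict] using h

/-! ### Forms vanishing on the fat points attached to a configuration of lines

For a finite set `S` of pairs and a finite set `A` of lines, `P(a, b)` with `(a, b) ∈ S` gets as
multiplicity the number of its coordinates that lie in `A`. -/

/-- The forms of degree `t` vanishing at the points of `S` to the order prescribed by `A`. -/
def vanishingSpace (k : Type*) [Field k] (S : Finset (ℕ × ℕ)) (A : Finset ℕ) (t : ℕ) :
    Submodule k (homogeneousSubmodule (Fin 3) k t) where
  carrier := {f | ∀ p ∈ S,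
    (p.1 ∈ A ∨ p.2 ∈ A → eval (pairVec (p.1 : k) p.2) (f : MvPolynomial (Fin 3) k) = 0) ∧
    (p.1 ∈ A ∧ p.2 ∈ A →
      eval (pairVec (p.1 : k) p.2) (pderiv 0 (f : MvPolynomial (Fin 3) k)) = 0 ∧
      eval (pairVec (p.1 : k) p.2) (pderiv 1 (f : MvPolynomial (Fin 3) k)) = 0)}
  zero_mem' := by simp
  add_mem' {f g} hf hg p hp := by
    refine ⟨fun h => ?_, fun h => ?_⟩
    · simp [(hf p hp).1 h, (hg p hp).1 h]
    · simp [(hf p hp).2 h, (hg p hp).2 h]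
  smul_mem' c f hf p hp := by
    refine ⟨fun h => ?_, fun h => ?_⟩
    · simp [(hf p hp).1 h, smul_eval]
    · simp [(hf p hp).2 h, smul_eval]

lemma mem_vanishingSpace {S : Finset (ℕ × ℕ)} {A : Finset ℕ} {t : ℕ}
    {f : homogeneousSubmodule (Fin 3) k t} :
    f ∈ vanishingSpace k S A t ↔ ∀ p ∈ S,
      (p.1 ∈ A ∨ p.2 ∈ A → eval (pairVec (p.1 : k) p.2) (f : MvPolynomial (Fin 3) k) = 0) ∧
      (p.1 ∈ A ∧ p.2 ∈ A →
        eval (pairVec (p.1 : k) p.2) (pderiv 0 (f : MvPolynomial (Fin 3) k)) = 0 ∧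
        eval (pairVec (p.1 : k) p.2) (pderiv 1 (f : MvPolynomial (Fin 3) k)) = 0) := Iff.rfl

/-- The pairs of `S` whose points lie on the line `r`. -/
def pairsOn (S : Finset (ℕ × ℕ)) (r : ℕ) : Finset (ℕ × ℕ) := S.filter fun p => p.1 = r ∨ p.2 = r

lemma mem_pairsOn {S : Finset (ℕ × ℕ)} {r : ℕ} {p : ℕ × ℕ} :
    p ∈ pairsOn S r ↔ p ∈ S ∧ (p.1 = r ∨ p.2 = r) := Finset.mem_filter

/-- The degree of the intersection with the line `r ∉ A` of the fat points attached to
`insert r A`. -/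
def lineDegree (S : Finset (ℕ × ℕ)) (A : Finset ℕ) (r : ℕ) : ℕ :=
  ∑ p ∈ pairsOn S r, if p.1 ∈ A ∨ p.2 ∈ A then 2 else 1

/-- The codimension of `vanishingSpace`. -/
def configHilbert (k : Type*) [Field k] (S : Finset (ℕ × ℕ)) (A : Finset ℕ) (t : ℕ) : ℕ :=
  Module.finrank k (homogeneousSubmodule (Fin 3) k t ⧸ vanishingSpace k S A t)

instance finite_homogeneousSubmodule (t : ℕ) :
    Module.Finite k (homogeneousSubmodule (Fin 3) k t) :=
  Module.Finite.iff_fg.2 (homogeneousSubmodule_fg _ _ t)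

/-- Dividing by the line form lowers the multiplicity by one at the points on the line, where the
form vanishes simply (its derivative along `x₀` is 1), and changes nothing at the other points,
where it is nonzero. -/
lemma comap_mulLineForm_vanishingSpace [CharZero k] {S : Finset (ℕ × ℕ)}
    (hS : ∀ p ∈ S, p.1 < p.2) {A : Finset ℕ} {r : ℕ} (hr : r ∉ A) (t : ℕ) :
    (vanishingSpace k S (insert r A) (t + 1)).comap (mulLineForm (r : k) t) =
      vanishingSpace k S A t := by
  ext g
  rw [Submodule.mem_comap, mem_vanishingSpace, mem_vanishingSpace]
  refine forall₂_congr fun p hp => ?_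
  have hne : p.1 ≠ p.2 := (hS p hp).ne
  rw [coe_mulLineForm]
  simp only [map_mul, map_add, Derivation.leibniz, smul_eq_mul, pderiv_zero_lineForm,
    pderiv_one_lineForm, eval_lineForm, map_one, eval_C]
  by_cases h1 : p.1 = r
  · have h2 : p.2 ≠ r := fun h => hne (h1.trans h.symm)
    simp only [h1, Finset.mem_insert, h2, hr, sub_self, zero_mul, false_or, false_and, mul_one,
      true_and, true_or, forall_const, zero_add, IsEmpty.forall_iff, and_true]
    refine forall_congr' fun _ => ⟨fun h => h.1, fun h => by simp [h]⟩
  by_cases h2 : p.2 = r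
  · simp only [h2, Finset.mem_insert, h1, hr, sub_self, mul_zero, zero_mul, false_or, mul_one,
      or_true, or_false, and_true, and_false, forall_const, zero_add,
      IsEmpty.forall_iff, true_and]
    refine forall_congr' fun _ => ⟨fun h => h.1, fun h => by simp [h]⟩
  · have e1 : (r : k) - p.1 ≠ 0 := sub_ne_zero.2 (by exact_mod_cast Ne.symm h1)
    have e2 : (r : k) - p.2 ≠ 0 := sub_ne_zero.2 (by exact_mod_cast Ne.symm h2)
    simp only [Finset.mem_insert, h1, h2, false_or, mul_eq_zero, e1, e2]
    constructor
    · rintro ⟨h, h'⟩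
      refine ⟨h, fun h3 => ?_⟩
      have := h' h3
      rw [h (Or.inl h3.1)] at this
      simpa [e1, e2] using this
    · rintro ⟨h, h'⟩
      refine ⟨h, fun h3 => ?_⟩
      rw [h (Or.inl h3.1), (h' h3).1, (h' h3).2]
      simp

/-- The polynomial on the line `r` cut out by the fat points attached to `insert r A`. -/
def linePolynomial (k : Type*) [Field k] (S : Finset (ℕ × ℕ)) (A : Finset ℕ) (r : ℕ) :
    Polynomial k :=
  ∏ p ∈ pairsOn S r, (Polynomial.X - Polynomial.C ((if p.1 = r then p.2 else p.1 : ℕ) : k)) ^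
    (if p.1 ∈ A ∨ p.2 ∈ A then 2 else 1)

lemma monic_linePolynomial (S : Finset (ℕ × ℕ)) (A : Finset ℕ) (r : ℕ) :
    (linePolynomial k S A r).Monic :=
  Polynomial.monic_prod_of_monic _ _ fun _ _ => (Polynomial.monic_X_sub_C _).pow _

lemma natDegree_linePolynomial (S : Finset (ℕ × ℕ)) (A : Finset ℕ) (r : ℕ) :
    (linePolynomial k S A r).natDegree = lineDegree S A r := by
  rw [linePolynomial, Polynomial.natDegree_prod_of_monic _ _ fun _ _ =>
    (Polynomial.monic_X_sub_C _).pow _]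
  simp only [Polynomial.natDegree_pow, Polynomial.natDegree_X_sub_C, mul_one]
  rfl

lemma sq_X_sub_C_dvd {F : Polynomial k} {s : k} (h0 : F.eval s = 0)
    (h1 : (Polynomial.derivative F).eval s = 0) : (Polynomial.X - Polynomial.C s) ^ 2 ∣ F := by
  by_cases hF : F = 0
  · rw [hF]
    exact dvd_zero _
  · rw [← Polynomial.le_rootMultiplicity_iff hF]
    exact (Polynomial.one_lt_rootMultiplicity_iff_isRoot hF).2 ⟨h0, h1⟩

lemma linePolynomial_dvd [CharZero k] {S : Finset (ℕ × ℕ)} (hS : ∀ p ∈ S, p.1 < p.2)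
    {A : Finset ℕ} {r t : ℕ} (hr : r ∉ A) {f : homogeneousSubmodule (Fin 3) k t}
    (hf : f ∈ vanishingSpace k S (insert r A) t) :
    linePolynomial k S A r ∣ lineRestrict (r : k) f := by
  refine Finset.prod_dvd_of_coprime ?_ ?_
  · intro p hp q hq hpq
    refine IsCoprime.pow (Polynomial.isCoprime_X_sub_C_of_isUnit_sub (IsUnit.mk0 _ ?_))
    rw [sub_ne_zero, Ne, Nat.cast_inj]
    rw [Finset.mem_coe, mem_pairsOn] at hp hq
    have h1 := hS p hp.1
    have h2 := hS q hq.1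
    intro h
    -- Distinct pairs on `r` have distinct other coordinates: `(r, b)` and `(b, r)` cannot both be
    -- increasing.
    refine hpq (Prod.ext ?_ ?_) <;> split_ifs at h <;> omega
  · intro p hp
    rw [mem_pairsOn] at hp
    obtain ⟨hpS, hpr⟩ := hp
    set s : ℕ := if p.1 = r then p.2 else p.1 with hs
    have hvec : pairVec (p.1 : k) p.2 = pairVec (r : k) s := by
      by_cases h : p.1 = r
      · rw [hs, if_pos h, h]
      · rw [hs, if_neg h, hpr.resolve_left h, pairVec_comm]
    have hfp := mem_vanishingSpace.1 hf p hpS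
    rw [hvec] at hfp
    have h0 : (lineRestrict (r : k) (f : MvPolynomial (Fin 3) k)).eval (s : k) = 0 := by
      rw [eval_lineRestrict]
      refine hfp.1 ?_
      rcases hpr with h | h <;> simp [h]
    split_ifs with hA
    · refine sq_X_sub_C_dvd h0 ?_
      have := hfp.2 (by rcases hpr with h | h <;> rcases hA with h' | h' <;> simp_all)
      rw [derivative_lineRestrict, Polynomial.eval_sub, Polynomial.eval_mul, eval_lineRestrict,
        eval_lineRestrict, this.1, this.2]
      simp
    · rw [pow_one]
      exact Polynomial.dvd_iff_isRoot.2 h0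

/-- The number of conditions imposed on forms of degree `t` restricted to the line `r`. -/
def lineConditions (k : Type*) [Field k] (S : Finset (ℕ × ℕ)) (A : Finset ℕ) (r t : ℕ) : ℕ :=
  Module.finrank k (Polynomial.degreeLT k (t + 1) ⧸
    (vanishingSpace k S (insert r A) t).map (formRestrict (r : k) t))

lemma lineConditions_le (S : Finset (ℕ × ℕ)) (A : Finset ℕ) (r t : ℕ) :
    lineConditions k S A r t ≤ t + 1 :=
  (Submodule.finrank_quotient_le _).trans_eq (finrank_degreeLT _)

lemma min_lineDegree_le_lineConditions [CharZero k] {S : Finset (ℕ × ℕ)}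
    (hS : ∀ p ∈ S, p.1 < p.2) {A : Finset ℕ} {r : ℕ} (hr : r ∉ A) (t : ℕ) :
    min (lineDegree S A r) (t + 1) ≤ lineConditions k S A r t := by
  rw [← natDegree_linePolynomial (k := k)]
  refine min_natDegree_le_finrank_quotient_degreeLT (monic_linePolynomial S A r).ne_zero _ ?_
  rintro _ ⟨f, hf, rfl⟩
  exact linePolynomial_dvd hS hr hf

/-- The residual sequence: forms of degree `t`, multiplied by the line form, make up the kernel of
the restriction to the line. -/
lemma configHilbert_insert_succ [CharZero k] {S : Finset (ℕ × ℕ)} (hS : ∀ p ∈ S, p.1 < p.2)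
    {A : Finset ℕ} {r : ℕ} (hr : r ∉ A) (t : ℕ) :
    configHilbert k S (insert r A) (t + 1) =
      configHilbert k S A t + lineConditions k S A r (t + 1) := by
  rw [configHilbert, finrank_quotient_eq_add_of_exact (mulLineForm (r : k) t)
    (formRestrict (r : k) (t + 1)) (formRestrict_surjective _ _) (ker_formRestrict_succ _ _),
    comap_mulLineForm_vanishingSpace hS hr]
  rfl

lemma configHilbert_insert_zero (S : Finset (ℕ × ℕ)) (A : Finset ℕ) (r : ℕ) :
    configHilbert k S (insert r A) 0 = lineConditions k S A r 0 := by
  rw [configHilbert, finrank_quotient_eq_add_of_exact (A := PUnit) 0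
    (formRestrict (r : k) 0) (formRestrict_surjective _ _)
    (by rw [ker_formRestrict_zero, LinearMap.range_zero]), lineConditions,
    Module.finrank_zero_of_subsingleton, zero_add]

/-- A point on `r` whose other line is in `A` is already a zero, so two derivatives are the only new
conditions; any other point on `r` costs one evaluation. -/
lemma configHilbert_insert_le {S : Finset (ℕ × ℕ)} (hS : ∀ p ∈ S, p.1 < p.2) (A : Finset ℕ)
    (r t : ℕ) :
    configHilbert k S (insert r A) t ≤ configHilbert k S A t + lineDegree S A r := by
  let ev (p : ℕ × ℕ) : MvPolynomial (Fin 3) k →ₗ[k] k := (aeval (pairVec (p.1 : k) p.2)).toLinearMap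
  let ι := (homogeneousSubmodule (Fin 3) k t).subtype
  let W (p : ℕ × ℕ) : Submodule k (homogeneousSubmodule (Fin 3) k t) :=
    if p.1 ∈ A ∨ p.2 ∈ A then
      LinearMap.ker ((((ev p).comp (pderiv 0).toLinearMap).comp ι).prod
        (((ev p).comp (pderiv 1).toLinearMap).comp ι))
    else LinearMap.ker ((ev p).comp ι)
  have hle : vanishingSpace k S A t ⊓ ⨅ p ∈ pairsOn S r, W p ≤
      vanishingSpace k S (insert r A) t := by
    rintro f ⟨hf, hf'⟩ p hp
    have hfp := mem_vanishingSpace.1 hf p hp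
    by_cases hpr : p.1 = r ∨ p.2 = r
    · have hW : f ∈ W p := by
        have := (Submodule.mem_iInf _).1 hf' p
        exact (Submodule.mem_iInf _).1 this (mem_pairsOn.2 ⟨hp, hpr⟩)
      by_cases hA : p.1 ∈ A ∨ p.2 ∈ A
      · simp only [W, if_pos hA] at hW
        exact ⟨fun _ => hfp.1 hA, fun _ => ⟨congrArg Prod.fst hW, congrArg Prod.snd hW⟩⟩
      · simp only [W, if_neg hA] at hW
        refine ⟨fun _ => hW, fun h => ?_⟩
        have h1 := hS p hp
        rw [Finset.mem_insert, Finset.mem_insert] at h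
        rw [not_or] at hA
        have h2 := h.1.resolve_right hA.1
        have h3 := h.2.resolve_right hA.2
        omega
    · rw [not_or] at hpr
      simpa [hpr.1, hpr.2] using hfp
  refine (finrank_quotient_anti hle).trans ((finrank_quotient_inf_iInf_le _ _ _).trans ?_)
  refine Nat.add_le_add_left (Finset.sum_le_sum fun p _ => ?_) _
  by_cases hA : p.1 ∈ A ∨ p.2 ∈ A
  · have hW : W p = _ := if_pos hA
    rw [hW, if_pos hA]
    refine (finrank_quotient_ker_le _).trans_eq ?_
    rw [Module.finrank_prod, Module.finrank_self]
  · have hW : W p = _ := if_neg hA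
    rw [hW, if_neg hA]
    exact (finrank_quotient_ker_le _).trans_eq (Module.finrank_self k)

lemma add_le_of_strictly_decreasing {c : ℕ → ℕ} {α : ℕ} (hc : ∀ j, j + 1 < α → c (j + 1) < c j)
    (i m : ℕ) (h : i + m < α) : c (i + m) + m ≤ c i := by
  induction m with
  | zero => simp
  | succ m ih =>
    have h1 := ih (by omega)
    have h2 := hc (i + m) (by omega)
    have h3 : i + (m + 1) = i + m + 1 := rfl
    rw [h3]
    omega

/-- The Hilbert function of the fat points attached to lines on which the successive residual
schemes have strictly decreasing degrees. -/
lemma configHilbert_Ico [CharZero k] {S : Finset (ℕ × ℕ)} (hS : ∀ p ∈ S, p.1 < p.2) {α : ℕ}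
    {c : ℕ → ℕ} (hc : ∀ j < α, lineDegree S (Finset.Ico (j + 1) α) j = c j)
    (hdec : ∀ j, j + 1 < α → c (j + 1) < c j) (n i : ℕ) (hi : i + n = α) (t : ℕ) :
    configHilbert k S (Finset.Ico i α) t = ∑ m ∈ Finset.range n, min (c (i + m)) (t + 1 - m) ∧
      configHilbert k S (Finset.Ico i α) t ≤ ∑ m ∈ Finset.range n, c (i + m) := by
  induction n generalizing i t with
  | zero =>
    have h : vanishingSpace k S (Finset.Ico i α) t = ⊤ := by
      rw [eq_top_iff]
      intro f _
      simp [mem_vanishingSpace, ← hi]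
    simp [configHilbert, h, Module.finrank_zero_of_subsingleton]
  | succ n ih =>
    have hIco : Finset.Ico i α = insert i (Finset.Ico (i + 1) α) :=
      (Finset.insert_Ico_add_one_left_eq_Ico (by omega)).symm
    have hnot : i ∉ Finset.Ico (i + 1) α := by simp
    have hidx : ∀ m, c (i + (m + 1)) = c (i + 1 + m) := fun m => by congr 1; omega
    have hup := configHilbert_insert_le (k := k) hS (Finset.Ico (i + 1) α) i t
    have hlow := min_lineDegree_le_lineConditions (k := k) hS hnot t
    have hle := lineConditions_le (k := k) S (Finset.Ico (i + 1) α) i t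
    rw [hc i (by omega)] at hup hlow
    rw [hIco, Finset.sum_range_succ', Finset.sum_range_succ', add_zero, Nat.sub_zero]
    simp only [hidx]
    have hup' := (ih (i + 1) (by omega) t).2
    refine ⟨?_, by omega⟩
    have hrec : configHilbert k S (insert i (Finset.Ico (i + 1) α)) t =
        ∑ m ∈ Finset.range n, min (c (i + 1 + m)) (t + 1 - (m + 1)) +
          lineConditions k S (Finset.Ico (i + 1) α) i t := by
      cases t with
      | zero =>
        rw [configHilbert_insert_zero, Finset.sum_eq_zero, zero_add]
        intro m _
        simp
      | succ t =>
        rw [configHilbert_insert_succ hS hnot, (ih (i + 1) (by omega) t).1]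
        simp only [Nat.add_sub_add_right]
    -- If `c i ≥ t + 1`, the restriction to the line must be zero, which is exactly `t + 1`
    -- conditions. Otherwise strict decrease makes every minimum equal to `c`, and the lower bound
    -- meets the upper bound by the total degree.
    rcases le_or_gt (t + 1) (c i) with h | h
    · rw [hrec]
      omega
    · have hfull : ∑ m ∈ Finset.range n, min (c (i + 1 + m)) (t + 1 - (m + 1)) =
          ∑ m ∈ Finset.range n, c (i + 1 + m) := by
        refine Finset.sum_congr rfl fun m hm => ?_
        have := add_le_of_strictly_decreasing hdec i (m + 1)
          (by have := Finset.mem_range.1 hm; omega)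
        rw [hidx] at this
        omega
      omega

/-! ### The set of fat points attached to a configuration -/

/-- The fat points supported at `P(a, b)` for `(a, b) ∈ S`, double if `b < α` and reduced
otherwise. -/
def configFatPoints (k : Type*) [Field k] (S : Finset (ℕ × ℕ)) (α : ℕ) : FatPoints k :=
  ∑ p ∈ S, Finsupp.single (pairPoint (p.1 : k) p.2) (if p.2 < α then 2 else 1)

section FatPoints

variable [CharZero k] {S : Finset (ℕ × ℕ)}

lemma injOn_pairPoint (hS : ∀ p ∈ S, p.1 < p.2) :
    Set.InjOn (fun p : ℕ × ℕ => pairPoint (p.1 : k) p.2) S := by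
  intro p hp q hq h
  have h1 := hS p hp
  have h2 := hS q hq
  rcases pairPoint_eq_iff.1 h with ⟨h3, h4⟩ | ⟨h3, h4⟩ <;> rw [Nat.cast_inj] at h3 h4
  · exact Prod.ext h3 h4
  · omega

lemma configFatPoints_apply (hS : ∀ p ∈ S, p.1 < p.2) (α : ℕ) {p : ℕ × ℕ}
    (hp : p ∈ S) :
    configFatPoints k S α (pairPoint (p.1 : k) p.2) = if p.2 < α then 2 else 1 := by
  classical
  rw [configFatPoints, Finsupp.finsetSum_apply, Finset.sum_eq_single p]
  · rw [Finsupp.single_eq_same]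
  · intro q hq hqp
    refine Finsupp.single_eq_of_ne fun h => hqp (injOn_pairPoint (k := k) hS hq hp h.symm)
  · exact fun h => absurd hp h

lemma mem_support_configFatPoints (hS : ∀ p ∈ S, p.1 < p.2) (α : ℕ) {P : Plane k} :
    P ∈ (configFatPoints k S α).support ↔ ∃ p ∈ S, pairPoint (p.1 : k) p.2 = P := by
  classical
  constructor
  · intro h
    have := Finsupp.support_finsetSum h
    simp only [Finset.mem_biUnion] at this
    obtain ⟨p, hp, h'⟩ := this
    exact ⟨p, hp, (Finset.mem_singleton.1 (Finsupp.support_single_subset h')).symm⟩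
  · rintro ⟨p, hp, rfl⟩
    rw [Finsupp.mem_support_iff, configFatPoints_apply hS α hp]
    split_ifs <;> decide

lemma idealPiece_configFatPoints (hS : ∀ p ∈ S, p.1 < p.2) (α : ℕ)
    (hα : ∀ p ∈ S, p.1 < α) (t : ℕ) :
    (configFatPoints k S α).idealPiece t = vanishingSpace k S (Finset.range α) t := by
  ext f
  have hf := (mem_homogeneousSubmodule _ _).1 f.2
  have h1 : f ∈ (configFatPoints k S α).idealPiece t ↔ ∀ p ∈ S, (f : MvPolynomial (Fin 3) k) ∈
      pointIdeal (pairPoint (p.1 : k) p.2) ^ (if p.2 < α then 2 else 1) := by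
    change (f : MvPolynomial (Fin 3) k) ∈ (configFatPoints k S α).ideal ↔ _
    simp only [FatPoints.ideal, Submodule.mem_iInf, mem_support_configFatPoints hS α]
    constructor
    · intro h p hp
      have := h _ ⟨p, hp, rfl⟩
      rwa [configFatPoints_apply hS α hp] at this
    · rintro h _ ⟨p, hp, rfl⟩
      rw [configFatPoints_apply hS α hp]
      exact h p hp
  rw [h1, mem_vanishingSpace]
  refine forall₂_congr fun p hp => ?_
  split_ifs with h
  · rw [mem_pointIdeal_sq_iff hf]
    simp [hα p hp, h]
  · rw [pow_one, mem_pointIdeal_iff hf]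
    simp [hα p hp, h]

lemma consistsOf_configFatPoints (hS : ∀ p ∈ S, p.1 < p.2) (α : ℕ) :
    (configFatPoints k S α).ConsistsOf (S.filter fun p => p.2 < α).card
      (S.filter fun p => ¬ p.2 < α).card := by
  classical
  refine ⟨?_, ?_, ?_⟩
  · intro P hP
    obtain ⟨p, hp, rfl⟩ := (mem_support_configFatPoints hS α).1 hP
    rw [configFatPoints_apply hS α hp]
    split_ifs <;> simp
  all_goals
    rw [← Finset.card_image_of_injOn ((injOn_pairPoint (k := k) hS).mono
      (Finset.coe_subset.2 (Finset.filter_subset _ S)))]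
    congr 1
    ext P
    simp only [Finset.mem_filter, mem_support_configFatPoints hS α, Finset.mem_image]
    constructor
    · rintro ⟨⟨p, hp, rfl⟩, h⟩
      rw [configFatPoints_apply hS α hp] at h
      refine ⟨p, ⟨hp, ?_⟩, rfl⟩
      by_contra h'
      simp [h'] at h
    · rintro ⟨p, ⟨hp, h⟩, rfl⟩
      refine ⟨⟨p, hp, rfl⟩, ?_⟩
      rw [configFatPoints_apply hS α hp]
      simp [h]

end FatPoints

end

/-! ### Conjugates of valid Hilbert functions -/

section Conjugate

variable {h : ℕ → ℕ} {α σ : ℕ}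

lemma IsValidHilbertFunction.antitone_of_le (hh : IsValidHilbertFunction h α σ) {m n : ℕ}
    (hm : α ≤ m + 1) (hmn : m ≤ n) : h n ≤ h m := by
  induction n, hmn using Nat.le_induction with
  | base => rfl
  | succ n hn ih => exact (hh.anti n (by omega)).trans ih

lemma IsValidHilbertFunction.le_alpha (hh : IsValidHilbertFunction h α σ) (m : ℕ) : h m ≤ α := by
  have hα := hh.alpha_pos
  rcases lt_or_ge m α with hm | hm
  · rw [hh.initial m hm]
    omega
  · have h1 := hh.antitone_of_le (m := α - 1) (n := m) (by omega) (by omega)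
    rw [hh.initial (α - 1) (by omega)] at h1
    omega

/-- As `h` climbs by steps of one and never rises again, each superlevel set is an interval; it
starts at `j`, and `conjugate` is its length. -/
lemma IsValidHilbertFunction.succ_le_iff (hh : IsValidHilbertFunction h α σ) {j : ℕ} (hj : j < α)
    (m : ℕ) : j + 1 ≤ h m ↔ j ≤ m ∧ m < j + conjugate h σ (j + 1) := by
  classical
  have hex : ∃ N, j ≤ N ∧ h N < j + 1 :=
    ⟨σ + 1, by have := hh.alpha_le; omega, by rw [hh.zero _ (Nat.lt_succ_self σ)]; omega⟩
  obtain ⟨N, ⟨hjN, hN⟩, hmin⟩ : ∃ N, (j ≤ N ∧ h N < j + 1) ∧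
      ∀ m, m < N → ¬ (j ≤ m ∧ h m < j + 1) :=
    ⟨Nat.find hex, Nat.find_spec hex, fun m hm => Nat.find_min hex hm⟩
  have hαN : α ≤ N := by
    by_contra hlt
    rw [hh.initial N (by omega)] at hN
    omega
  have hσN : N ≤ σ + 1 := by
    by_contra hlt
    refine hmin (σ + 1) (by omega) ⟨by have := hh.alpha_le; omega, ?_⟩
    rw [hh.zero _ (Nat.lt_succ_self σ)]
    omega
  have key : ∀ m, j + 1 ≤ h m ↔ j ≤ m ∧ m < N := by
    intro m
    constructor
    · intro hm
      constructor
      · by_contra hlt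
        rw [hh.initial m (by omega)] at hm
        omega
      · by_contra hle
        have := hh.antitone_of_le (m := N) (n := m) (by omega) (by omega)
        omega
    · rintro ⟨h1, h2⟩
      have := hmin m h2
      omega
  have hcard : conjugate h σ (j + 1) = N - j := by
    rw [conjugate, ← Nat.card_Ico]
    congr 1
    ext m
    rw [Finset.mem_filter, key, Finset.mem_range, Finset.mem_Ico]
    omega
  rw [key, hcard]
  omega

lemma IsValidHilbertFunction.conjugate_pos (hh : IsValidHilbertFunction h α σ) {j : ℕ}
    (hj : j < α) : 0 < conjugate h σ (j + 1) := by
  have := (hh.succ_le_iff hj j).1 (hh.initial j hj).ge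
  omega

/-- The superlevel intervals are nested and their left ends move right by one at each level. -/
lemma IsValidHilbertFunction.conjugate_succ_lt (hh : IsValidHilbertFunction h α σ) {j : ℕ}
    (hj : j + 1 < α) : conjugate h σ (j + 1 + 1) < conjugate h σ (j + 1) := by
  have h0 := hh.conjugate_pos hj
  have h1 := (hh.succ_le_iff hj (j + conjugate h σ (j + 1 + 1))).2 (by omega)
  have h2 := (hh.succ_le_iff (j := j) (by omega) (j + conjugate h σ (j + 1 + 1))).1 (by omega)
  omega

lemma IsValidHilbertFunction.sum_eq_sum_card (hh : IsValidHilbertFunction h α σ) (s : Finset ℕ) :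
    ∑ m ∈ s, h m = ∑ j ∈ Finset.range α, (s.filter fun m => j + 1 ≤ h m).card := by
  simp only [Finset.card_filter]
  rw [Finset.sum_comm]
  refine Finset.sum_congr rfl fun m _ => ?_
  rw [← Finset.card_filter]
  have : (Finset.range α).filter (fun j => j + 1 ≤ h m) = Finset.range (h m) := by
    ext j
    have := hh.le_alpha m
    simp only [Finset.mem_filter, Finset.mem_range]
    omega
  rw [this, Finset.card_range]

lemma IsValidHilbertFunction.totalSum_eq (hh : IsValidHilbertFunction h α σ) :
    totalSum h σ = ∑ j ∈ Finset.range α, conjugate h σ (j + 1) := by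
  rw [totalSum, hh.sum_eq_sum_card]
  rfl

lemma IsValidHilbertFunction.sumFunction_eq (hh : IsValidHilbertFunction h α σ) (t : ℕ) :
    sumFunction h t = ∑ j ∈ Finset.range α, min (conjugate h σ (j + 1)) (t + 1 - j) := by
  rw [sumFunction, hh.sum_eq_sum_card]
  refine Finset.sum_congr rfl fun j hj => ?_
  have : (Finset.range (t + 1)).filter (fun m => j + 1 ≤ h m) =
      Finset.Ico j (min (t + 1) (j + conjugate h σ (j + 1))) := by
    ext m
    simp only [Finset.mem_filter, Finset.mem_range, hh.succ_le_iff (Finset.mem_range.1 hj),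
      Finset.mem_Ico, lt_min_iff]
    tauto
  rw [this, Nat.card_Ico]
  omega

end Conjugate

/-! ### Choosing the double points -/

section Choice

/-- The pairs `(i, j)` with `i < n` and `j ∈ T i`. -/
def fiberedPairs (n : ℕ) (T : ℕ → Finset ℕ) : Finset (ℕ × ℕ) :=
  ((Finset.range n).sigma T).map (Equiv.sigmaEquivProd ℕ ℕ).toEmbedding

lemma mem_fiberedPairs {n : ℕ} {T : ℕ → Finset ℕ} {p : ℕ × ℕ} :
    p ∈ fiberedPairs n T ↔ p.1 < n ∧ p.2 ∈ T p.1 := by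
  simp [fiberedPairs]

lemma card_fiberedPairs (n : ℕ) (T : ℕ → Finset ℕ) :
    (fiberedPairs n T).card = ∑ i ∈ Finset.range n, (T i).card := by
  rw [fiberedPairs, Finset.card_map, Finset.card_sigma]

lemma card_filter_fst_fiberedPairs {n : ℕ} (T : ℕ → Finset ℕ) {i : ℕ} (hi : i < n) :
    ((fiberedPairs n T).filter fun p => p.1 = i).card = (T i).card := by
  rw [← Finset.card_image_of_injective (T i) (Prod.mk_right_injective i)]
  congr 1
  ext p
  simp only [Finset.mem_filter, mem_fiberedPairs, Finset.mem_image]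
  constructor
  · rintro ⟨⟨_, h⟩, rfl⟩
    exact ⟨p.2, h, rfl⟩
  · rintro ⟨j, hj, rfl⟩
    exact ⟨⟨hi, hj⟩, rfl⟩

/-- Double points can be placed on the pairwise intersections of `α` lines with prescribed
capacities `c`. -/
lemma exists_pairs_of_le (c : ℕ → ℕ) (α e : ℕ)
    (he : e ≤ ∑ i ∈ Finset.range α,
      min ((c i - i) / 2) ((Finset.Ioo i α).filter fun j => i + 1 ≤ c j).card) :
    ∃ E : Finset (ℕ × ℕ), E.card = e ∧ (∀ p ∈ E, p.1 < p.2 ∧ p.2 < α) ∧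
      ∀ i < α, 2 * (E.filter fun p => p.1 = i).card + (E.filter fun p => p.2 = i).card ≤ c i := by
  have hT : ∀ i, ∃ T : Finset ℕ, T ⊆ ((Finset.Ioo i α).filter fun j => i + 1 ≤ c j) ∧
      T.card = min ((c i - i) / 2) ((Finset.Ioo i α).filter fun j => i + 1 ≤ c j).card :=
    fun i => Finset.exists_subset_card_eq (min_le_right _ _)
  choose T hTsub hTcard using hT
  obtain ⟨E, hE, hEcard⟩ := Finset.exists_subset_card_eq (s := fiberedPairs α T) (n := e) (by
    rw [card_fiberedPairs]
    simpa only [hTcard] using he)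
  have hmem : ∀ p ∈ E, (p.1 < p.2 ∧ p.2 < α) ∧ p.1 + 1 ≤ c p.2 := by
    intro p hp
    have := hTsub _ (mem_fiberedPairs.1 (hE hp)).2
    simpa using this
  refine ⟨E, hEcard, fun p hp => (hmem p hp).1, fun i hi => ?_⟩
  have hout : (E.filter fun p => p.1 = i).card ≤ (c i - i) / 2 := by
    refine (Finset.card_le_card (Finset.filter_subset_filter _ hE)).trans ?_
    rw [card_filter_fst_fiberedPairs T hi, hTcard]
    exact min_le_left _ _
  -- An incoming pair `(j, i)` has `j < i` and `j + 1 ≤ c i`. The bound `i` serves when `i ≤ c i`;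
  -- otherwise `(c i - i) / 2 = 0` and the bound `c i` suffices.
  have hin : (E.filter fun p => p.2 = i).card ≤ min i (c i) := by
    have hsub : (E.filter fun p => p.2 = i) ⊆
        (Finset.range (min i (c i))).image fun j => (j, i) := by
      intro p hp
      rw [Finset.mem_filter] at hp
      obtain ⟨hp, rfl⟩ := hp
      have := hmem p hp
      exact Finset.mem_image.2 ⟨p.1, Finset.mem_range.2 (by omega), rfl⟩
    exact (Finset.card_le_card hsub).trans (Finset.card_image_le.trans (Finset.card_range _).le)
  omega

/-- Reduced points on the lines complete a set of double points to given line degrees. -/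
lemma exists_configuration (c : ℕ → ℕ) (α e : ℕ) {E : Finset (ℕ × ℕ)} (hcard : E.card = e)
    (hE : ∀ p ∈ E, p.1 < p.2 ∧ p.2 < α)
    (hcap : ∀ i < α,
      2 * (E.filter fun p => p.1 = i).card + (E.filter fun p => p.2 = i).card ≤ c i) :
    ∃ S : Finset (ℕ × ℕ), (∀ p ∈ S, p.1 < p.2 ∧ p.1 < α) ∧
      (S.filter fun p => p.2 < α).card = e ∧
      (S.filter fun p => ¬ p.2 < α).card + 3 * e = ∑ i ∈ Finset.range α, c i ∧
      ∀ i < α, lineDegree S (Finset.Ico (i + 1) α) i = c i := by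
  set out : ℕ → ℕ := fun i => (E.filter fun p => p.1 = i).card with hout
  set inn : ℕ → ℕ := fun i => (E.filter fun p => p.2 = i).card with hinn
  -- Auxiliary lines with parameters from `α` on cut out the reduced points that use up the spare
  -- capacity of `L_i`.
  set F := fiberedPairs α fun i => Finset.Ico α (α + (c i - (2 * out i + inn i))) with hFdef
  have hF : ∀ p ∈ F, p.1 < α ∧ α ≤ p.2 := by
    intro p hp
    have := mem_fiberedPairs.1 hp
    rw [Finset.mem_Ico] at this
    exact ⟨this.1, this.2.1⟩
  have hdisj : Disjoint E F := Finset.disjoint_left.2 fun p h1 h2 => by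
    have := hE p h1
    have := hF p h2
    omega
  have hout_sum : ∑ i ∈ Finset.range α, out i = e := by
    rw [← hcard]
    refine (Finset.card_eq_sum_card_fiberwise fun p hp => ?_).symm
    have := hE p hp
    simp
    omega
  have hinn_sum : ∑ i ∈ Finset.range α, inn i = e := by
    rw [← hcard]
    refine (Finset.card_eq_sum_card_fiberwise fun p hp => ?_).symm
    have := hE p hp
    simp
    omega
  refine ⟨E ∪ F, ?_, ?_, ?_, ?_⟩
  · intro p hp
    rcases Finset.mem_union.1 hp with h | h
    · have := hE p h
      omega
    · have := hF p h
      omega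
  · rw [← hcard]
    congr 1
    ext p
    rw [Finset.mem_filter, Finset.mem_union]
    constructor
    · rintro ⟨h | h, h'⟩
      · exact h
      · have := hF p h
        omega
    · exact fun h => ⟨Or.inl h, (hE p h).2⟩
  · have : (E ∪ F).filter (fun p => ¬ p.2 < α) = F := by
      ext p
      rw [Finset.mem_filter, Finset.mem_union]
      constructor
      · rintro ⟨h | h, h'⟩
        · exact absurd (hE p h).2 h'
        · exact h
      · exact fun h => ⟨Or.inr h, not_lt.2 (hF p h).2⟩
    rw [this, hFdef, card_fiberedPairs]
    have h3 : 3 * e = ∑ i ∈ Finset.range α, (2 * out i + inn i) := by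
      rw [Finset.sum_add_distrib, ← Finset.mul_sum, hout_sum, hinn_sum]
      ring
    rw [h3, ← Finset.sum_add_distrib]
    refine Finset.sum_congr rfl fun i hi => ?_
    have := hcap i (Finset.mem_range.1 hi)
    simp only [Nat.card_Ico]
    simp only [hout, hinn]
    omega
  · intro i hi
    rw [lineDegree, pairsOn, Finset.sum_filter, Finset.sum_union hdisj]
    have h1 : (∑ p ∈ E, if p.1 = i ∨ p.2 = i then
        (if p.1 ∈ Finset.Ico (i + 1) α ∨ p.2 ∈ Finset.Ico (i + 1) α then 2 else 1) else 0) =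
        2 * out i + inn i := by
      simp only [hout, hinn, Finset.card_filter, Finset.mul_sum]
      rw [← Finset.sum_add_distrib]
      refine Finset.sum_congr rfl fun p hp => ?_
      have := hE p hp
      simp only [Finset.mem_Ico]
      split_ifs <;> omega
    have h2 : (∑ p ∈ F, if p.1 = i ∨ p.2 = i then
        (if p.1 ∈ Finset.Ico (i + 1) α ∨ p.2 ∈ Finset.Ico (i + 1) α then 2 else 1) else 0) =
        (F.filter fun p => p.1 = i).card := by
      rw [Finset.card_filter]
      refine Finset.sum_congr rfl fun p hp => ?_
      have := hF p hp
      simp only [Finset.mem_Ico]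
      split_ifs <;> omega
    rw [h1, h2, hFdef, card_filter_fst_fiberedPairs _ hi, Nat.card_Ico]
    have := hcap i hi
    simp only [hout, hinn]
    omega

end Choice

/-! ### The main theorem -/

lemma doublePointNumber_eq (h : ℕ → ℕ) (α σ : ℕ) :
    doublePointNumber h α σ = ∑ i ∈ Finset.range (α - 1),
      min ((conjugate h σ (i + 1) - i) / 2)
        ((Finset.Ioo i α).filter fun j => i + 1 ≤ conjugate h σ (j + 1)).card := by
  rw [doublePointNumber, ← Finset.Ico_succ_right_eq_Icc, Finset.sum_Ico_eq_sum_range]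
  refine Finset.sum_congr (by simp) fun i _ => ?_
  rw [add_comm 1 i, Nat.add_sub_cancel]
  congr 1
  refine Eq.symm ((Finset.card_map (addRightEmbedding 1)).symm.trans (congrArg Finset.card ?_))
  ext j
  simp only [Finset.mem_filter, Finset.mem_Icc, Finset.mem_map, Finset.mem_Ioo,
    addRightEmbedding_apply]
  constructor
  · rintro ⟨j, ⟨h1, h2⟩, rfl⟩
    exact ⟨by omega, h2⟩
  · rintro ⟨h1, h2⟩
    refine ⟨j - 1, ⟨by omega, ?_⟩, by omega⟩
    rwa [Nat.sub_add_cancel (by omega)]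

lemma doublePointNumber_le_choose (h : ℕ → ℕ) (α σ : ℕ) :
    doublePointNumber h α σ ≤ α.choose 2 := by
  rw [doublePointNumber_eq, Nat.choose_two_right, ← Finset.sum_range_id,
    ← Finset.sum_range_reflect (fun i => i) α]
  refine le_trans (Finset.sum_le_sum fun i _ => (min_le_right _ _).trans ?_)
    (Finset.sum_le_sum_of_subset (Finset.range_mono (Nat.sub_le α 1)))
  refine (Finset.card_filter_le _ _).trans ?_
  rw [Nat.card_Ioo]
  omega

lemma IsValidHilbertFunction.min_le_doublePointNumber {h : ℕ → ℕ} {α σ : ℕ}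
    (hh : IsValidHilbertFunction h α σ) :
    min ((σ + 1) / 2) (α - 1) ≤ doublePointNumber h α σ := by
  rcases Nat.eq_zero_or_pos (α - 1) with h0 | h0
  · simp [h0]
  rw [doublePointNumber_eq]
  -- The first summand alone already equals the lower bound.
  refine le_trans ?_ (Finset.single_le_sum (fun _ _ => Nat.zero_le _) (Finset.mem_range.2 h0))
  have h1 : conjugate h σ (0 + 1) = σ + 1 := by
    rw [conjugate, Finset.filter_true_of_mem, Finset.card_range]
    intro j hj
    exact hh.pos j (Nat.lt_succ_iff.1 (Finset.mem_range.1 hj))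
  have h2 : (Finset.Ioo 0 α).filter (fun j => 0 + 1 ≤ conjugate h σ (j + 1)) = Finset.Ioo 0 α :=
    Finset.filter_true_of_mem fun j hj => hh.conjugate_pos (Finset.mem_Ioo.1 hj).2
  rw [h1, h2, Nat.card_Ioo]
  simp

lemma IsValidHilbertFunction.exists_fatPoints (k : Type*) [Field k] [CharZero k] {h : ℕ → ℕ}
    {α σ : ℕ} (hh : IsValidHilbertFunction h α σ) {e : ℕ} (he : e ≤ doublePointNumber h α σ) :
    3 * e ≤ totalSum h σ ∧ ∃ Z : FatPoints k, Z.ConsistsOf e (totalSum h σ - 3 * e) ∧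
      Z.hilbertFunction = sumFunction h := by
  set c : ℕ → ℕ := fun j => conjugate h σ (j + 1) with hc
  obtain ⟨E, hEcard, hE, hcap⟩ := exists_pairs_of_le c α e (by
    rw [doublePointNumber_eq] at he
    -- Here the sum runs over all `α` lines, one more than in `d`; the extra summand is harmless.
    exact he.trans (Finset.sum_le_sum_of_subset (Finset.range_mono (Nat.sub_le _ _))))
  obtain ⟨S, hS, hdouble, hreduced, hdeg⟩ := exists_configuration c α e hEcard hE hcap
  rw [← hh.totalSum_eq] at hreduced
  have hS' : ∀ p ∈ S, p.1 < p.2 := fun p hp => (hS p hp).1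
  refine ⟨by omega, configFatPoints k S α, ?_, ?_⟩
  · have := consistsOf_configFatPoints (k := k) hS' α
    rw [hdouble] at this
    rwa [← hreduced, Nat.add_sub_cancel]
  · funext t
    rw [FatPoints.hilbertFunction, idealPiece_configFatPoints hS' α (fun p hp => (hS p hp).2),
      hh.sumFunction_eq, Finset.range_eq_Ico]
    have := (configHilbert_Ico (k := k) hS' hdeg (fun j hj => hh.conjugate_succ_lt hj) α 0
      (zero_add α) t).1
    simp only [zero_add, Finset.range_eq_Ico] at this
    exact this

theorem mainTheorem6 (k : Type*) [Field k] [IsAlgClosed k] [CharZero k]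
    (h : ℕ → ℕ) (α σ : ℕ) (hh : IsValidHilbertFunction h α σ) :
    (min ((σ + 1) / 2) (α - 1) ≤ doublePointNumber h α σ ∧
      doublePointNumber h α σ ≤ Nat.choose α 2) ∧
    (∀ e : ℕ, 1 ≤ e → e ≤ doublePointNumber h α σ →
      3 * e ≤ totalSum h σ ∧
      ∃ Z : FatPoints k, Z.ConsistsOf e (totalSum h σ - 3 * e) ∧
        Z.hilbertFunction = sumFunction h) ∧
    (∀ e : ℕ, e = min ((σ + 1) / 2) (α - 1) →
      3 * e ≤ totalSum h σ ∧
      ∃ Z : FatPoints k, Z.ConsistsOf e (totalSum h σ - 3 * e) ∧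
        Z.hilbertFunction = sumFunction h) :=
  ⟨⟨hh.min_le_doublePointNumber, doublePointNumber_le_choose h α σ⟩,
    fun _ _ he => hh.exists_fatPoints k he,
    fun _ he => hh.exists_fatPoints k (he.le.trans hh.min_le_doublePointNumber)⟩
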